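/- **Theorem 2.1.** Let $n\ge 0$ and $Q\ge 1$ be integers, let $f=(f_1,\dots,f_Q)$ with $f_a>0$ and $\sum_a f_a=1$, and let $\pi=(\pi_{a,b})_{1\le a,b\le Q}$ be a symmetric matrix with entries in $[0,1]$. In the stochastic block model $SBM(n,\pi,f)$, the $n$ vertices independently receive classes in $\{1,\dots,Q\}$ with distribution $f$ and, conditionally on the classes, each pair $\{i,j\}$ of distinct vertices is an edge with probability $\pi_{a,b}$, where $a,b$ are the classes of $i,j$, independently over pairs. Put $\pi^*=\max_{1\le a,b\le Q}\pi_{a,b}$. Let $G$ be a finite simple graph with $v(G)$ vertices, $e(G)>1$ edges and $a(G)$ automorphisms. For a graph $H$ with at least one vertex put $d(H)=e(H)/v(H)$, and suppose that $G$ is strictly balanced: $d(H)<d(G)$ for every subgraph $H\subsetneq G$ with at least one vertex. Put $\rho(G)=v(G)!/a(G)$ and $$\alpha(G)=\min_{H:\,v(H)<v(G)}\frac{e(G)-e(H)}{v(G)-v(H)},\qquad \gamma(G)=\min_H\bigl(d(G)v(H)-e(H)\bigr),$$ where $H$ ranges over the non-empty subgraphs $H\subsetneq G$ without isolated vertices (in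 the first minimum, only over those with $v(H)<v(G)$), and for $2\le s\le v(G)-1$ $$\kappa(G,s)=\max\bigl(e(G)-s\,d(G)+\gamma(G),\ (v(G)-s)\,\alpha(G)\bigr).$$ Let $W$ be the number of (not necessarily induced) copies of $G$ in $SBM(n,\pi,f)$, that is, the number of subgraphs of the random graph that are isomorphic to $G$, and let $\lambda=\mathbb{E}W$. Then $$d_{TV}(\mathcal L(W),\mathrm{Po}(\lambda))\le(1-e^{-\lambda})\rho(G)\left\{\frac{2v(G)^2}{v(G)!}\,n^{v(G)-1}(\pi^*)^{e(G)}+\pi^*+\sum_{s=2}^{v(G)-1}\binom{v(G)}{s}\frac{n^{v(G)-s}(\pi^*)^{\kappa(G,s)}}{(v(G)-s)!}\right\},$$ where $d_{TV}(\mu,\nu)=\sup_{A\subseteq\mathbb Z_{\ge0}}|\mu(A)-\nu(A)|$ and $\mathrm{Po}(0)$ is the point mass at $0$. -/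

import Mathlib

open MeasureTheory ProbabilityTheory

noncomputable section

namespace SBMPoisson

/-! ### The stochastic block model -/

/-- The probability, in `SBM(n, π, f)`, that vertex `i` has class `c i` for every `i` and that the
random graph is exactly `g`: classes are independent with distribution `f`, and given the classes
the pairs `i < j` are edges independently, with probability `π (c i) (c j)`. -/
def jointMass {n Q : ℕ} (π : Fin Q → Fin Q → ℝ) (f : Fin Q → ℝ)
    (c : Fin n → Fin Q) (g : SimpleGraph (Fin n)) : ℝ := by
  classical exact
    (∏ i, f (c i)) *
      ∏ i, ∏ j ∈ Finset.Ioi i, if g.Adj i j then π (c i) (c j) else 1 - π (c i) (c j)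

/-- The law of the random graph `SBM(n, π, f)` on the vertex set `Fin n` with `Q` classes
(the marginal on graphs of the joint law of classes and graph). -/
def sbmLaw (n : ℕ) {Q : ℕ} (π : Fin Q → Fin Q → ℝ) (f : Fin Q → ℝ) :
    Measure (SimpleGraph (Fin n)) := by
  classical exact
    ∑ g : SimpleGraph (Fin n),
      ENNReal.ofReal (∑ c : Fin n → Fin Q, jointMass π f c g) • Measure.dirac g

/-- The maximum edge probability `π*`. -/
def maxEdgeProb {Q : ℕ} (π : Fin Q → Fin Q → ℝ) : ℝ :=
  ⨆ ab : Fin Q × Fin Q, π ab.1 ab.2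

/-- The law of `W`, the number of (not necessarily induced) copies of `G` in `SBM(n, π, f)`.
`SimpleGraph.copyCount g G` is the number of subgraphs of `g` isomorphic to `G`. -/
def copyLaw {V : Type*} (n : ℕ) {Q : ℕ} (π : Fin Q → Fin Q → ℝ) (f : Fin Q → ℝ)
    (G : SimpleGraph V) : Measure ℕ :=
  (sbmLaw n π f).map fun g => g.copyCount G

/-- The expectation `λ = E W` of the number of copies of `G` in `SBM(n, π, f)`. -/
def expectedCopies {V : Type*} (n : ℕ) {Q : ℕ} (π : Fin Q → Fin Q → ℝ) (f : Fin Q → ℝ)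
    (G : SimpleGraph V) : ℝ :=
  ∫ g, (g.copyCount G : ℝ) ∂(sbmLaw n π f)

/-- Total variation distance between two laws on the non-negative integers. -/
def tvDist (μ ν : Measure ℕ) : ℝ :=
  ⨆ A : Set ℕ, |μ.real A - ν.real A|

/-! ### Quantities attached to a finite graph -/

section Graph

/-- The number of vertices `v(G)`. -/
def numV {V : Type*} (_G : SimpleGraph V) : ℕ := Nat.card V

variable {V : Type*} (G : SimpleGraph V)

/-- The number of edges `e(G)`. -/
def numE : ℕ := G.edgeSet.ncard

/-- The density `d(G) = e(G) / v(G)`. -/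
def density : ℝ := (numE G : ℝ) / (numV G : ℝ)

variable {G} in
/-- The number of vertices `v(H)` of a subgraph `H` of `G`. -/
def subV (H : G.Subgraph) : ℕ := H.verts.ncard

variable {G} in
/-- The number of edges `e(H)` of a subgraph `H` of `G`. -/
def subE (H : G.Subgraph) : ℕ := H.edgeSet.ncard

/-- `G` is strictly balanced: `d(H) < d(G)` for every proper (non-empty) subgraph `H` of `G`. -/
def StrictlyBalanced : Prop :=
  ∀ H : G.Subgraph, H ≠ ⊤ → H.verts.Nonempty → (subE H : ℝ) / (subV H : ℝ) < density G

/-- `ρ(G) = v(G)! / a(G)`, where `a(G)` is the order of the automorphism group of `G`. -/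
def rho : ℝ := ((numV G).factorial : ℝ) / (Nat.card (G ≃g G) : ℝ)

variable {G} in
/-- `H` is a proper, non-empty subgraph of `G` without isolated vertices. -/
def Admissible (H : G.Subgraph) : Prop :=
  H ≠ ⊤ ∧ H.verts.Nonempty ∧ ∀ x ∈ H.verts, ∃ y, H.Adj x y

/-- `α(G)`: the minimum of `(e(G) - e(H)) / (v(G) - v(H))` over the admissible subgraphs `H` for
which the quotient makes sense, that is, those with fewer vertices than `G`. -/
def alphaG : ℝ :=
  ⨅ H : {H : G.Subgraph // Admissible H ∧ subV H < numV G},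
    ((numE G : ℝ) - subE H.1) / ((numV G : ℝ) - subV H.1)

/-- `γ(G)`: the minimum of `d(G) v(H) - e(H)` over the admissible subgraphs `H`. -/
def gammaG : ℝ :=
  ⨅ H : {H : G.Subgraph // Admissible H}, (density G * subV H.1 - subE H.1)

/-- `κ(G, s) = max (e(G) - s d(G) + γ(G), (v(G) - s) α(G))`. -/
def kappa (s : ℕ) : ℝ :=
  max ((numE G : ℝ) - s * density G + gammaG G) (((numV G : ℝ) - s) * alphaG G)

end Graph

end SBMPoisson

end

/-!
The bound is the local form of the Chen–Stein method, applied to the indicators `X a` of the events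
that the random graph contains `a`, where `a` runs over the copies of `G` in the complete graph on
`Fin n`; then `W = ∑ X a`.

*Stein's equation.* For the Poisson law with rate `r` and a set `A`, the equation
`r f(k+1) - k f(k) = 1_A(k) - Po(A)` has an explicit solution `steinSol r A`, whose increments
`f(k+2) - f(k+1)` are at most `(1 - e^{-r}) / r` in absolute value (`abs_steinSol_sub_le`). Inserting
`W` and taking expectations gives `chenStein_local`, as soon as `X a` is independent of the sum of
the `X b` over the `b` outside a neighbourhood of `a`.

*Independence.* The neighbourhood of `a` consists of the copies that share a vertex with `a`. Two
copies that share a single vertex share no edge, but they are dependent through the class of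
this vertex. Functions of the subgraphs induced on complementary vertex sets are independent
(`wsum_sbmMass_mul`): conditionally on the classes, and then for the conditional expectations as
functions of the classes, the same exchange argument `wsum_mul_wsum_of_swap` applies.

*Moments.* Given the classes, the probability of containing a graph is the product of the edge
probabilities, so `E[X a X b] ≤ E[X a] π*^m` with `m` the number of edges of `b` outside `a`. If `a`
and `b` share one vertex then `m = e(G)`; if `a ≠ b` have the same vertices then `m ≥ 1`; if they
share `s` vertices with `2 ≤ s < v(G)` then their common edges form a subgraph of `G` without isolated
vertices on at most `s` vertices, so that `m ≥ κ(G, s)` by the definition of `κ` (`kappa_le`).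

*Counting.* A given vertex set carries at most `ρ(G)` copies, and the vertex sets that meet a given
one in `s` points are counted by binomial coefficients (`Copies.card_nbhd_le`,
`Copies.sum_nbhd_erase_le`). Since `∑ E[X a] = λ`, the factor `1 / λ` of the Stein bound cancels.
-/

/-! ### The Stein equation of the Poisson law -/

namespace PoissonStein

open scoped NNReal

variable {r : ℝ≥0}

theorem succ_mul_mass_succ (r : ℝ≥0) (k : ℕ) :
    ((k : ℝ) + 1) * (poissonMeasure r).real {k + 1} = r * (poissonMeasure r).real {k} := by
  rw [poissonMeasure_real_singleton, poissonMeasure_real_singleton, Nat.factorial_succ]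
  push_cast
  field_simp
  ring

theorem real_inter_Iic_succ (r : ℝ≥0) (A : Set ℕ) (k : ℕ) :
    (poissonMeasure r).real (A ∩ Set.Iic (k + 1)) =
      (poissonMeasure r).real (A ∩ Set.Iic k) + (poissonMeasure r).real (A ∩ {k + 1}) := by
  rw [← measureReal_union _ (.of_discrete)]
  · congr 1
    ext x
    simp only [Set.mem_inter_iff, Set.mem_Iic, Set.mem_union, Set.mem_singleton_iff]
    have : x ≤ k + 1 ↔ x ≤ k ∨ x = k + 1 := by omega
    tauto
  · rw [Set.disjoint_left]
    simp only [Set.mem_inter_iff, Set.mem_Iic, Set.mem_singleton_iff]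
    omega

theorem real_Iic_succ (r : ℝ≥0) (k : ℕ) :
    (poissonMeasure r).real (Set.Iic (k + 1)) =
      (poissonMeasure r).real (Set.Iic k) + (poissonMeasure r).real {k + 1} := by
  simpa using real_inter_Iic_succ r Set.univ k

theorem real_Iic_zero (r : ℝ≥0) : (poissonMeasure r).real (Set.Iic 0) = Real.exp (-r) := by
  have : (Set.Iic 0 : Set ℕ) = {0} := by ext; simp
  rw [this, poissonMeasure_real_singleton]
  simp

theorem real_Iic_eq_sum (r : ℝ≥0) (k : ℕ) :
    (poissonMeasure r).real (Set.Iic k) =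
      ∑ j ∈ Finset.range (k + 1), (poissonMeasure r).real {j} := by
  induction k with
  | zero =>
    have : (Set.Iic 0 : Set ℕ) = {0} := by ext; simp
    simp [this]
  | succ k ih => rw [real_Iic_succ, ih, Finset.sum_range_succ _ (k + 1)]

/-- The distribution function of the Poisson law, divided by its mass function, is
nondecreasing, with a gain that comes from the mass at `0`. -/
theorem mul_real_Iic_le (r : ℝ≥0) (k : ℕ) :
    r * (poissonMeasure r).real (Set.Iic k) ≤
      (k + 1) * ((poissonMeasure r).real (Set.Iic (k + 1)) - Real.exp (-r)) := by
  induction k with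
  | zero =>
    have h := succ_mul_mass_succ r 0
    have h0 : (Set.Iic 0 : Set ℕ) = {0} := by ext; simp
    rw [real_Iic_succ, real_Iic_zero]
    rw [← h0, real_Iic_zero] at h
    push_cast at h ⊢
    linarith
  | succ k ih =>
    have h := succ_mul_mass_succ r (k + 1)
    have h1 : Real.exp (-r) ≤ (poissonMeasure r).real (Set.Iic (k + 1)) := by
      rw [← real_Iic_zero]
      exact measureReal_mono (Set.Iic_subset_Iic.2 (Nat.zero_le _))
    rw [real_Iic_succ r (k + 1)]
    have h2 := real_Iic_succ r k
    push_cast at h ⊢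
    nlinarith

/-- The tail of the Poisson law, divided by its mass function, is nonincreasing. -/
theorem succ_mul_tail_le (r : ℝ≥0) (k : ℕ) :
    (k + 1) * (1 - (poissonMeasure r).real (Set.Iic (k + 1))) ≤
      r * (1 - (poissonMeasure r).real (Set.Iic k)) := by
  have hs : HasSum (fun j ↦ (poissonMeasure r).real {j}) 1 := by
    simpa only [poissonMeasure_real_singleton] using hasSum_one_poissonMeasure r
  have h1 := ((hasSum_nat_add_iff' (k + 2)).2 hs).mul_left ((k : ℝ) + 1)
  have h2 := ((hasSum_nat_add_iff' (k + 1)).2 hs).mul_left (r : ℝ)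
  rw [real_Iic_eq_sum, real_Iic_eq_sum]
  refine hasSum_le (fun j ↦ ?_) h1 h2
  have h := succ_mul_mass_succ r (j + (k + 1))
  rw [← h]
  refine mul_le_mul_of_nonneg_right ?_ measureReal_nonneg
  push_cast
  have : (0 : ℝ) ≤ j := Nat.cast_nonneg j
  linarith

/-- The solution of the Stein equation of the Poisson law with rate `r` for the indicator of `A`;
see `steinSol_eq`. The value at `0` plays no role and is set to `0`. -/
noncomputable def steinSol (r : ℝ≥0) (A : Set ℕ) : ℕ → ℝ
  | 0 => 0
  | k + 1 => ((poissonMeasure r).real (A ∩ Set.Iic k) -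
      (poissonMeasure r).real A * (poissonMeasure r).real (Set.Iic k)) /
        (r * (poissonMeasure r).real {k})

theorem real_inter_singleton (r : ℝ≥0) (A : Set ℕ) (k : ℕ) :
    (poissonMeasure r).real (A ∩ {k}) =
      A.indicator 1 k * (poissonMeasure r).real {k} := by
  by_cases h : k ∈ A
  · rw [Set.inter_eq_right.2 (Set.singleton_subset_iff.2 h)]; simp [h]
  · rw [Set.inter_singleton_eq_empty.2 h]; simp [h]

theorem steinSol_eq (hr : 0 < r) (A : Set ℕ) (k : ℕ) :
    r * steinSol r A (k + 1) - k * steinSol r A k =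
      A.indicator 1 k - (poissonMeasure r).real A := by
  have hr' : (0 : ℝ) < r := hr
  cases k with
  | zero =>
    have h0 : (Set.Iic 0 : Set ℕ) = {0} := by ext; simp
    have hp := poissonMeasure_real_singleton_pos 0 hr
    simp only [steinSol, h0, real_inter_singleton]
    field_simp
    simp
  | succ k =>
    have hp := poissonMeasure_real_singleton_pos k hr
    have hp' := poissonMeasure_real_singleton_pos (k + 1) hr
    have h := succ_mul_mass_succ r k
    simp only [steinSol]
    rw [real_inter_Iic_succ, real_Iic_succ, real_inter_singleton, ← h]
    push_cast
    field_simp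
    ring

theorem steinSol_compl (A : Set ℕ) (k : ℕ) : steinSol r Aᶜ k = -steinSol r A k := by
  cases k with
  | zero => simp [steinSol]
  | succ k =>
    have h1 : (poissonMeasure r).real Aᶜ = 1 - (poissonMeasure r).real A :=
      probReal_compl_eq_one_sub .of_discrete
    have h2 : (poissonMeasure r).real (Aᶜ ∩ Set.Iic k) =
        (poissonMeasure r).real (Set.Iic k) - (poissonMeasure r).real (A ∩ Set.Iic k) := by
      have := measureReal_inter_add_sdiff (μ := poissonMeasure r) (s := Set.Iic k) (t := A)
        .of_discrete
      rw [Set.sdiff_eq, Set.inter_comm, Set.inter_comm _ Aᶜ] at this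
      linarith
    simp only [steinSol, h1, h2]
    ring

theorem steinSol_sub_le (hr : 0 < r) (A : Set ℕ) (k : ℕ) :
    steinSol r A (k + 2) - steinSol r A (k + 1) ≤ (1 - Real.exp (-r)) / r := by
  have hr' : (0 : ℝ) < r := hr
  have hp := poissonMeasure_real_singleton_pos k hr
  have hp' := poissonMeasure_real_singleton_pos (k + 1) hr
  have h := succ_mul_mass_succ r k
  have hI := mul_real_Iic_le r k
  have hT := succ_mul_tail_le r k
  have hS := real_Iic_succ r k
  have hAS := real_inter_Iic_succ r A k
  rw [real_inter_singleton] at hAS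
  have hA : (poissonMeasure r).real A = (poissonMeasure r).real (A ∩ Set.Iic (k + 1)) +
      (poissonMeasure r).real (A \ Set.Iic (k + 1)) :=
    (measureReal_inter_add_sdiff (μ := poissonMeasure r) (s := A) .of_discrete).symm
  have hu0 : 0 ≤ (poissonMeasure r).real (A ∩ Set.Iic k) := measureReal_nonneg
  have hw0 : 0 ≤ (poissonMeasure r).real (A \ Set.Iic (k + 1)) := measureReal_nonneg
  have hF0 : 0 ≤ (poissonMeasure r).real (Set.Iic k) := measureReal_nonneg
  have hF1 : (poissonMeasure r).real (Set.Iic (k + 1)) ≤ 1 := measureReal_le_one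
  have hδ0 : 0 ≤ A.indicator (1 : ℕ → ℝ) (k + 1) := Set.indicator_nonneg (by simp) _
  have hδ1 : A.indicator (1 : ℕ → ℝ) (k + 1) ≤ 1 :=
    Set.indicator_le_self' (by simp) _
  simp only [steinSol]
  rw [hA, hAS]
  generalize (poissonMeasure r).real (A ∩ Set.Iic k) = u at *
  generalize (poissonMeasure r).real (A \ Set.Iic (k + 1)) = w at *
  generalize A.indicator (1 : ℕ → ℝ) (k + 1) = δ at *
  generalize (poissonMeasure r).real (Set.Iic k) = F at *
  generalize (poissonMeasure r).real (Set.Iic (k + 1)) = F' at *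
  generalize (poissonMeasure r).real {k} = p at *
  generalize (poissonMeasure r).real {k + 1} = q at *
  generalize hedef : Real.exp (-r) = e at *
  have hk : (0 : ℝ) < k + 1 := by positivity
  have hpe : p = (k + 1) * q / r := by field_simp; linarith
  have he : 0 ≤ e := by rw [← hedef]; positivity
  have key : ((u + δ * q) - (u + δ * q + w) * F') / (r * q) -
      (u - (u + δ * q + w) * F) / (r * p) =
      (u * (((k + 1) * (1 - F') - r * (1 - F)) / ((k + 1) * q)) -
        w * (((k + 1) * F' - r * F) / ((k + 1) * q)) +
        δ * ((1 - F') + r * F / (k + 1))) / r := by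
    rw [hpe]
    field_simp
    ring
  rw [key]
  gcongr
  have t1 : u * (((k + 1) * (1 - F') - r * (1 - F)) / ((k + 1) * q)) ≤ 0 :=
    mul_nonpos_of_nonneg_of_nonpos hu0 (div_nonpos_of_nonpos_of_nonneg (by linarith) (by positivity))
  have t2 : 0 ≤ w * (((k + 1) * F' - r * F) / ((k + 1) * q)) :=
    mul_nonneg hw0 (div_nonneg (by nlinarith) (by positivity))
  have t3 : r * F / (k + 1) ≤ F' - e := by rw [div_le_iff₀ hk]; linarith
  have t4 : 0 ≤ r * F / (k + 1) := by positivity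
  have t5 : δ * ((1 - F') + r * F / (k + 1)) ≤ 1 * ((1 - F') + r * F / (k + 1)) :=
    mul_le_mul_of_nonneg_right hδ1 (by linarith)
  linarith

/-- The magic factor: the increments of the solution of the Stein equation, away from the
value at `0`, are at most `(1 - e^{-r}) / r`. -/
theorem abs_steinSol_sub_le (hr : 0 < r) (A : Set ℕ) (k : ℕ) :
    |steinSol r A (k + 2) - steinSol r A (k + 1)| ≤ (1 - Real.exp (-r)) / r := by
  rw [abs_le]
  refine ⟨?_, steinSol_sub_le hr A k⟩
  -- Passing to the complement of `A` changes the sign of the solution.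
  have := steinSol_sub_le hr Aᶜ k
  rw [steinSol_compl, steinSol_compl] at this
  linarith

theorem abs_steinSol_sub_le_mul (hr : 0 < r) (A : Set ℕ) (k m : ℕ) :
    |steinSol r A (k + m + 1) - steinSol r A (k + 1)| ≤ (1 - Real.exp (-r)) / r * m := by
  induction m with
  | zero => simp
  | succ m ih =>
    have h := abs_steinSol_sub_le hr A (k + m)
    have h3 := abs_sub_le (steinSol r A (k + (m + 1) + 1)) (steinSol r A (k + m + 1))
      (steinSol r A (k + 1))
    push_cast
    have e1 : k + (m + 1) + 1 = k + m + 2 := by ring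
    rw [e1] at h3 ⊢
    linarith

end PoissonStein

namespace SBMPoisson

/-! ### Expectations on finite spaces -/

section FiniteExpectation

variable {Ω : Type*} [Fintype Ω]

/-- The sum of `F` against the weights `p` on a finite type. It is the expectation of `F` when
`p` is the mass function of a probability law. -/
def wsum (p F : Ω → ℝ) : ℝ := ∑ ω, p ω * F ω

theorem wsum_sub (p F F' : Ω → ℝ) :
    wsum p (fun ω ↦ F ω - F' ω) = wsum p F - wsum p F' := by
  simp [wsum, mul_sub]

theorem wsum_const_mul (p F : Ω → ℝ) (c : ℝ) : wsum p (fun ω ↦ c * F ω) = c * wsum p F := by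
  simp [wsum, Finset.mul_sum, mul_left_comm]

theorem wsum_sum {κ : Type*} (s : Finset κ) (p : Ω → ℝ) (F : κ → Ω → ℝ) :
    wsum p (fun ω ↦ ∑ k ∈ s, F k ω) = ∑ k ∈ s, wsum p (F k) := by
  simp only [wsum, Finset.mul_sum]
  exact Finset.sum_comm

theorem wsum_mono {p : Ω → ℝ} (hp : ∀ ω, 0 ≤ p ω) {F F' : Ω → ℝ} (h : ∀ ω, F ω ≤ F' ω) :
    wsum p F ≤ wsum p F' :=
  Finset.sum_le_sum fun ω _ ↦ mul_le_mul_of_nonneg_left (h ω) (hp ω)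

theorem wsum_nonneg {p : Ω → ℝ} (hp : ∀ ω, 0 ≤ p ω) {F : Ω → ℝ} (h : ∀ ω, 0 ≤ F ω) :
    0 ≤ wsum p F :=
  Finset.sum_nonneg fun ω _ ↦ mul_nonneg (hp ω) (h ω)

theorem abs_wsum_le {p : Ω → ℝ} (hp : ∀ ω, 0 ≤ p ω) (F : Ω → ℝ) :
    |wsum p F| ≤ wsum p (fun ω ↦ |F ω|) := by
  refine (Finset.abs_sum_le_sum_abs _ _).trans_eq (Finset.sum_congr rfl fun ω _ ↦ ?_)
  rw [abs_mul, abs_of_nonneg (hp ω)]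

theorem wsum_const {p : Ω → ℝ} (hp : ∑ ω, p ω = 1) (c : ℝ) : wsum p (fun _ ↦ c) = c := by
  simp [wsum, ← Finset.sum_mul, hp]

end FiniteExpectation

/-! ### The local Chen–Stein bound -/

section ChenStein

open scoped NNReal
open PoissonStein

variable {Ω ι : Type*} [Fintype Ω] [Fintype ι] [DecidableEq ι]

/-- The local Chen–Stein bound: `X a` are indicators, and `X a` is independent of the sum of all
`X b` with `b` outside the neighbourhood `B a`. -/
theorem chenStein_local {p : Ω → ℝ} (hp : ∀ ω, 0 ≤ p ω) (hp1 : ∑ ω, p ω = 1)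
    (X : ι → Ω → ℕ) (hX : ∀ a ω, X a ω = 0 ∨ X a ω = 1)
    (B : ι → Finset ι) (hB : ∀ a, a ∈ B a)
    (hind : ∀ a (h : ℕ → ℝ), wsum p (fun ω ↦ X a ω * h (∑ b ∈ (B a)ᶜ, X b ω)) =
      wsum p (fun ω ↦ X a ω) * wsum p (fun ω ↦ h (∑ b ∈ (B a)ᶜ, X b ω)))
    {r : ℝ≥0} (hr : 0 < r) (hrX : (r : ℝ) = ∑ a, wsum p (fun ω ↦ X a ω)) (A : Set ℕ) :
    |wsum p (fun ω ↦ A.indicator 1 (∑ a, X a ω)) - (poissonMeasure r).real A| ≤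
      (1 - Real.exp (-r)) / r * ∑ a,
        (wsum p (fun ω ↦ X a ω) * ∑ b ∈ B a, wsum p (fun ω ↦ X b ω) +
          ∑ b ∈ (B a).erase a, wsum p (fun ω ↦ (X a ω : ℝ) * X b ω)) := by
  set f := steinSol r A with hf
  set C := (1 - Real.exp (-r)) / r with hC
  set W : Ω → ℕ := fun ω ↦ ∑ a, X a ω with hW
  have hsplit : ∀ a ω, W ω = (∑ b ∈ (B a)ᶜ, X b ω) + ∑ b ∈ B a, X b ω := fun a ω ↦
    ((add_comm _ _).trans (Finset.sum_add_sum_compl (B a) fun b ↦ X b ω)).symm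
  -- Stein's equation at `W`, with `W f(W)` written as `∑ X a f(W)`.
  have hstein : wsum p (fun ω ↦ A.indicator 1 (W ω)) - (poissonMeasure r).real A =
      ∑ a, (wsum p (fun ω ↦ X a ω) * wsum p (fun ω ↦ f (W ω + 1)) -
        wsum p (fun ω ↦ X a ω * f (W ω))) := by
    have h1 : wsum p (fun ω ↦ r * f (W ω + 1) - W ω * f (W ω)) =
        wsum p (fun ω ↦ A.indicator 1 (W ω) - (poissonMeasure r).real A) := by
      congr 1
      funext ω
      exact steinSol_eq hr A (W ω)
    rw [wsum_sub, wsum_sub, wsum_const hp1, wsum_const_mul] at h1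
    rw [← h1, Finset.sum_sub_distrib, ← Finset.sum_mul, ← hrX, ← wsum_sum]
    congr 2
    funext ω
    rw [← Finset.sum_mul]
    simp [hW]
  change |wsum p (fun ω ↦ A.indicator 1 (W ω)) - (poissonMeasure r).real A| ≤ _
  rw [hstein, Finset.mul_sum]
  refine (Finset.abs_sum_le_sum_abs _ _).trans (Finset.sum_le_sum fun a _ ↦ ?_)
  -- Both `f(W + 1)` and `f(W)` are compared with `f(U + 1)`, where `U` sums over `(B a)ᶜ`; on
  -- `X a = 1` all arguments are positive, so that the value `f 0` never enters.
  have hdecomp : wsum p (fun ω ↦ X a ω) * wsum p (fun ω ↦ f (W ω + 1)) -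
        wsum p (fun ω ↦ X a ω * f (W ω)) =
      wsum p (fun ω ↦ X a ω) *
          wsum p (fun ω ↦ f (W ω + 1) - f ((∑ b ∈ (B a)ᶜ, X b ω) + 1)) +
        wsum p (fun ω ↦ X a ω * (f ((∑ b ∈ (B a)ᶜ, X b ω) + 1) - f (W ω))) := by
    have := hind a (fun k ↦ f (k + 1))
    simp only [mul_sub]
    rw [wsum_sub, wsum_sub, this]
    ring
  have hpa : 0 ≤ wsum p (fun ω ↦ (X a ω : ℝ)) := wsum_nonneg hp fun ω ↦ Nat.cast_nonneg _
  rw [hdecomp, mul_add]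
  refine (abs_add_le _ _).trans (add_le_add ?_ ?_)
  · rw [abs_mul, abs_of_nonneg hpa, mul_left_comm]
    refine mul_le_mul_of_nonneg_left ?_ hpa
    rw [← wsum_sum, ← wsum_const_mul]
    refine (abs_wsum_le hp _).trans (wsum_mono hp fun ω ↦ ?_)
    rw [hsplit a ω, ← Nat.cast_sum]
    exact abs_steinSol_sub_le_mul hr A _ _
  · rw [← wsum_sum, ← wsum_const_mul]
    refine (abs_wsum_le hp _).trans (wsum_mono hp fun ω ↦ ?_)
    rcases hX a ω with h | h
    · simp [h]
    · have hWa : W ω = (∑ b ∈ (B a)ᶜ, X b ω) + (∑ b ∈ (B a).erase a, X b ω) + 1 := by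
        rw [hsplit a ω, ← Finset.sum_erase_add _ _ (hB a), h, add_assoc]
      rw [hWa, h, Nat.cast_one, one_mul, abs_sub_comm]
      simp only [one_mul]
      rw [← Nat.cast_sum]
      exact abs_steinSol_sub_le_mul hr A _ _

end ChenStein

/-! ### Exchange of independent parts -/

section Swap

variable {Ω : Type*} [Fintype Ω]

/-- If `mix a b` takes from `a` what `A` depends on and from `b` what `B` depends on, then
exchanging the parts of `a` and `b` on which `A` depends decouples `A` from `B`. Taking `w = w'`
gives independence; taking `B = 1` compares the expectations of `A` under `w` and `w'`. -/
theorem wsum_mul_wsum_of_swap (mix : Ω → Ω → Ω) (hmix : ∀ a b, mix (mix a b) (mix b a) = a)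
    (w w' A B : Ω → ℝ) (hw : ∀ a b, w (mix b a) * w' (mix a b) = w a * w' b)
    (hA : ∀ a b, A (mix a b) = A a) (hB : ∀ a b, B (mix a b) = B b) :
    wsum w A * wsum w' B = (∑ a, w a) * wsum w' (fun a ↦ A a * B a) := by
  let e : Ω × Ω ≃ Ω × Ω :=
    { toFun := fun x ↦ (mix x.2 x.1, mix x.1 x.2)
      invFun := fun x ↦ (mix x.2 x.1, mix x.1 x.2)
      left_inv := fun x ↦ Prod.ext (hmix _ _) (hmix _ _)
      right_inv := fun x ↦ Prod.ext (hmix _ _) (hmix _ _) }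
  have h1 : wsum w A * wsum w' B = ∑ x : Ω × Ω, w x.1 * A x.1 * (w' x.2 * B x.2) := by
    rw [Fintype.sum_prod_type, wsum, wsum, Finset.sum_mul_sum]
  have h2 : (∑ a, w a) * wsum w' (fun a ↦ A a * B a) =
      ∑ x : Ω × Ω, w x.1 * (w' x.2 * (A x.2 * B x.2)) := by
    rw [Fintype.sum_prod_type, wsum, Finset.sum_mul_sum]
  rw [h1, h2, ← e.sum_comp]
  refine (Finset.sum_congr rfl fun x _ ↦ ?_)
  have hx : e (mix x.2 x.1, mix x.1 x.2) = x := e.apply_symm_apply x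
  change w (mix x.2 x.1) * A (mix x.2 x.1) * (w' (mix x.1 x.2) * B (mix x.1 x.2)) = _
  rw [hA, hB]
  linear_combination (A x.2 * B x.2) * hw x.1 x.2

end Swap

/-! ### Random graphs with independent edges -/

section RandomGraph

open Classical in
/-- The probability that the random graph on `Fin n` whose pairs `i < j` are edges independently
with probability `w i j` is exactly `g`. -/
noncomputable def graphMass {n : ℕ} (w : Fin n → Fin n → ℝ) (g : SimpleGraph (Fin n)) : ℝ :=
  ∏ i, ∏ j ∈ Finset.Ioi i, if g.Adj i j then w i j else 1 - w i j

open Classical in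
/-- The indicator of the event that the graph `g` contains the graph `F`. -/
noncomputable def containsInd {V : Type*} (F g : SimpleGraph V) : ℕ := if F ≤ g then 1 else 0

/-- The function `A` of a graph depends only on the edges with both ends in `S`. -/
def LocalOn {V β : Type*} (S : Set V) (A : SimpleGraph V → β) : Prop :=
  ∀ g g' : SimpleGraph V, (∀ i ∈ S, ∀ j ∈ S, (g.Adj i j ↔ g'.Adj i j)) → A g = A g'

/-- The graph that agrees with `g` inside `S` and with `g'` on all other pairs. -/
def mixGraph {V : Type*} (S : Set V) (g g' : SimpleGraph V) : SimpleGraph V where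
  Adj i j := (i ∈ S ∧ j ∈ S) ∧ g.Adj i j ∨ ¬(i ∈ S ∧ j ∈ S) ∧ g'.Adj i j
  symm := ⟨fun i j h ↦ by rwa [g.adj_comm, g'.adj_comm, and_comm (a := j ∈ S)]⟩
  loopless := ⟨fun i h ↦ by simp at h⟩

variable {n : ℕ}

theorem mixGraph_adj_of_mem {V : Type*} {S : Set V} {i j : V} (h : i ∈ S ∧ j ∈ S)
    {g g' : SimpleGraph V} : (mixGraph S g g').Adj i j ↔ g.Adj i j := by
  simp only [mixGraph]
  tauto

theorem mixGraph_adj_of_not_mem {V : Type*} {S : Set V} {i j : V} (h : ¬(i ∈ S ∧ j ∈ S))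
    {g g' : SimpleGraph V} : (mixGraph S g g').Adj i j ↔ g'.Adj i j := by
  simp only [mixGraph]
  tauto

theorem mixGraph_mix {V : Type*} (S : Set V) (g g' : SimpleGraph V) :
    mixGraph S (mixGraph S g g') (mixGraph S g' g) = g := by
  ext i j
  simp only [mixGraph]
  tauto

theorem LocalOn.apply_mix_left {V β : Type*} {S : Set V} {A : SimpleGraph V → β}
    (hA : LocalOn S A) (g g' : SimpleGraph V) : A (mixGraph S g g') = A g :=
  hA _ _ fun _ hi _ hj ↦ mixGraph_adj_of_mem ⟨hi, hj⟩

theorem LocalOn.apply_mix_right {V β : Type*} {S : Set V} {B : SimpleGraph V → β}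
    (hB : LocalOn Sᶜ B) (g g' : SimpleGraph V) : B (mixGraph S g g') = B g' :=
  hB _ _ fun _ hi _ _ ↦ mixGraph_adj_of_not_mem fun h ↦ hi h.1

theorem graphMass_mix_mul (S : Set (Fin n)) {w w' : Fin n → Fin n → ℝ}
    (h : ∀ i ∈ S, ∀ j ∈ S, w i j = w' i j) (g g' : SimpleGraph (Fin n)) :
    graphMass w (mixGraph S g' g) * graphMass w' (mixGraph S g g') =
      graphMass w g * graphMass w' g' := by
  simp only [graphMass, ← Finset.prod_mul_distrib]
  refine Finset.prod_congr rfl fun i _ ↦ Finset.prod_congr rfl fun j _ ↦ ?_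
  by_cases hij : i ∈ S ∧ j ∈ S
  · have e1 := mixGraph_adj_of_mem hij (g := g) (g' := g')
    have e2 := mixGraph_adj_of_mem hij (g := g') (g' := g)
    rw [h i hij.1 j hij.2, mul_comm]
    by_cases hg : g.Adj i j <;> by_cases hg' : g'.Adj i j <;>
      simp only [e1, e2, hg, hg', if_true, if_false]
  · have e1 := mixGraph_adj_of_not_mem hij (g := g) (g' := g')
    have e2 := mixGraph_adj_of_not_mem hij (g := g') (g' := g)
    by_cases hg : g.Adj i j <;> by_cases hg' : g'.Adj i j <;>
      simp only [e1, e2, hg, hg', if_true, if_false]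

open Classical in
/-- The probability that all edges of `F` are present is the product of their probabilities:
expanding the product over pairs of `w i j + (1 - w i j)`, with the second summand deleted on the
edges of `F`, gives the sum over the graphs that contain `F`. -/
theorem wsum_graphMass_contains (w : Fin n → Fin n → ℝ) (F : SimpleGraph (Fin n)) :
    wsum (graphMass w) (fun g ↦ containsInd F g) =
      ∏ i, ∏ j ∈ Finset.Ioi i, if F.Adj i j then w i j else 1 := by
  set P : Finset (Σ _ : Fin n, Fin n) := Finset.univ.sigma fun i ↦ Finset.Ioi i with hP
  have hmemP : ∀ x, x ∈ P ↔ x.1 < x.2 := fun x ↦ by simp [hP]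
  have hfac : ∀ x : Σ _ : Fin n, Fin n, (if F.Adj x.1 x.2 then w x.1 x.2 else 1) =
      w x.1 x.2 + if F.Adj x.1 x.2 then 0 else 1 - w x.1 x.2 := fun x ↦ by split_ifs <;> ring
  rw [Finset.prod_sigma']
  change _ = ∏ x ∈ P, if F.Adj x.1 x.2 then w x.1 x.2 else 1
  rw [Finset.prod_congr rfl fun x _ ↦ hfac x, Finset.prod_add, wsum]
  refine Finset.sum_bij' (fun g _ ↦ P.filter fun x ↦ g.Adj x.1 x.2)
    (fun t _ ↦ SimpleGraph.fromRel fun i j ↦ i < j ∧ (⟨i, j⟩ : Σ _ : Fin n, Fin n) ∈ t)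
    (fun g _ ↦ Finset.mem_powerset.2 (Finset.filter_subset _ _)) (fun t _ ↦ Finset.mem_univ _)
    (fun g _ ↦ ?_) (fun t ht ↦ ?_) (fun g _ ↦ ?_)
  · ext i j
    simp only [SimpleGraph.fromRel_adj, Finset.mem_filter, hmemP, g.adj_comm j i]
    constructor
    · tauto
    · intro h
      have := h.ne
      rcases lt_or_gt_of_ne this with h' | h' <;> tauto
  · ext ⟨i, j⟩
    simp only [SimpleGraph.fromRel_adj, Finset.mem_filter, hmemP]
    constructor
    · rintro ⟨h1, h2, h3 | h3⟩
      · exact h3.2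
      · exact absurd h1 h3.1.not_gt
    · intro h
      have h1 : i < j := (hmemP _).1 (Finset.mem_powerset.1 ht h)
      exact ⟨h1, h1.ne, Or.inl ⟨h1, h⟩⟩
  · rw [graphMass, Finset.prod_sigma']
    change (∏ x ∈ P, if g.Adj x.1 x.2 then w x.1 x.2 else 1 - w x.1 x.2) * _ = _
    rw [Finset.prod_ite, mul_assoc, ← Finset.filter_not]
    congr 1
    by_cases hFg : F ≤ g
    · simp only [containsInd, hFg, if_true, Nat.cast_one, mul_one]
      refine Finset.prod_congr rfl fun x hx ↦ ?_
      rw [if_neg fun h ↦ (Finset.mem_filter.1 hx).2 (hFg h)]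
    · simp only [containsInd, hFg, if_false, Nat.cast_zero, mul_zero]
      obtain ⟨i, j, hij, hF, hg⟩ : ∃ i j, i < j ∧ F.Adj i j ∧ ¬g.Adj i j := by
        by_contra! hcon
        refine hFg fun i j h ↦ ?_
        rcases lt_or_gt_of_ne h.ne with h' | h'
        · exact hcon i j h' h
        · exact (hcon j i h' h.symm).symm
      refine (Finset.prod_eq_zero (i := ⟨i, j⟩) ?_ ?_).symm
      · simp [hmemP, hij, hg]
      · simp [hF]

theorem sum_graphMass (w : Fin n → Fin n → ℝ) : ∑ g, graphMass w g = 1 := by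
  have := wsum_graphMass_contains w ⊥
  simpa [wsum, containsInd] using this

theorem graphMass_nonneg {w : Fin n → Fin n → ℝ} (h0 : ∀ i j, 0 ≤ w i j) (h1 : ∀ i j, w i j ≤ 1)
    (g : SimpleGraph (Fin n)) : 0 ≤ graphMass w g := by
  refine Finset.prod_nonneg fun i _ ↦ Finset.prod_nonneg fun j _ ↦ ?_
  split_ifs
  · exact h0 i j
  · exact sub_nonneg.2 (h1 i j)

theorem wsum_graphMass_mul {S : Set (Fin n)} {w w' : Fin n → Fin n → ℝ}
    (h : ∀ i ∈ S, ∀ j ∈ S, w i j = w' i j) {A B : SimpleGraph (Fin n) → ℝ}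
    (hA : LocalOn S A) (hB : LocalOn Sᶜ B) :
    wsum (graphMass w) A * wsum (graphMass w') B = wsum (graphMass w') (fun g ↦ A g * B g) := by
  rw [wsum_mul_wsum_of_swap (mixGraph S) (mixGraph_mix S) _ _ A B (graphMass_mix_mul S h)
    hA.apply_mix_left hB.apply_mix_right, sum_graphMass, one_mul]

/-- The expectation of a function of the edges inside `S` depends only on the edge probabilities
inside `S`. -/
theorem wsum_graphMass_congr {S : Set (Fin n)} {w w' : Fin n → Fin n → ℝ}
    (h : ∀ i ∈ S, ∀ j ∈ S, w i j = w' i j) {A : SimpleGraph (Fin n) → ℝ} (hA : LocalOn S A) :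
    wsum (graphMass w) A = wsum (graphMass w') A := by
  have := wsum_graphMass_mul h hA (B := fun _ ↦ 1) (fun _ _ _ ↦ rfl)
  simpa [wsum_const (sum_graphMass w')] using this

open Classical in
theorem prod_ite_adj_eq_pow (H : SimpleGraph (Fin n)) (q : ℝ) :
    (∏ i, ∏ j ∈ Finset.Ioi i, if H.Adj i j then q else 1) = q ^ H.edgeSet.ncard := by
  rw [Finset.prod_sigma']
  rw [Finset.prod_ite, Finset.prod_const_one, mul_one, Finset.prod_const]
  congr 1
  rw [← Set.ncard_coe_finset]
  refine Set.ncard_congr (fun x _ ↦ s(x.1, x.2)) ?_ ?_ ?_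
  · rintro ⟨i, j⟩ h
    simp at h
    exact h.2
  · rintro ⟨i, j⟩ ⟨k, l⟩ h h' heq
    simp at h h'
    rcases Sym2.eq_iff.1 heq with ⟨h1, h2⟩ | ⟨h1, h2⟩
    · simp only at h1 h2; subst h1; subst h2; rfl
    · simp only at h1 h2; subst h1; subst h2; exact absurd h.1 h'.1.not_gt
  · intro e
    induction e using Sym2.ind with
    | _ i j =>
      intro h
      have h : H.Adj i j := h
      rcases lt_or_gt_of_ne h.ne with h' | h'
      · exact ⟨⟨i, j⟩, by simp [h, h'], rfl⟩
      · exact ⟨⟨j, i⟩, by simp [h.symm, h'], Sym2.eq_swap⟩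

theorem containsInd_mul {V : Type*} (F F' g : SimpleGraph V) :
    containsInd F g * containsInd F' g = containsInd (F ⊔ F') g := by
  simp only [containsInd, sup_le_iff]
  split_ifs <;> simp_all

theorem wsum_graphMass_contains_mul_le {w : Fin n → Fin n → ℝ} {q : ℝ}
    (h0 : ∀ i j, 0 ≤ w i j) (hq : ∀ i j, w i j ≤ q) (F F' : SimpleGraph (Fin n)) :
    wsum (graphMass w) (fun g ↦ (containsInd F g : ℝ) * containsInd F' g) ≤
      wsum (graphMass w) (fun g ↦ containsInd F g) * q ^ (F' \ F).edgeSet.ncard := by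
  classical
  simp_rw [← Nat.cast_mul, containsInd_mul]
  rw [wsum_graphMass_contains, wsum_graphMass_contains, ← prod_ite_adj_eq_pow,
    ← Finset.prod_mul_distrib]
  refine Finset.prod_le_prod (fun i _ ↦ Finset.prod_nonneg fun j _ ↦ ?_) fun i _ ↦ ?_
  · split_ifs
    exacts [h0 i j, zero_le_one]
  rw [← Finset.prod_mul_distrib]
  refine Finset.prod_le_prod (fun j _ ↦ ?_) fun j _ ↦ ?_
  · split_ifs
    exacts [h0 i j, zero_le_one]
  · by_cases hF : F.Adj i j <;> by_cases hF' : F'.Adj i j <;>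
      simp [hF, hF', hq i j]

end RandomGraph

/-! ### The mixture over the classes -/

section SBM


variable {n Q : ℕ}

/-- The probability that the random graph `SBM(n, π, f)` is exactly `g`. -/
noncomputable def sbmMass (π : Fin Q → Fin Q → ℝ) (f : Fin Q → ℝ) (g : SimpleGraph (Fin n)) : ℝ :=
  ∑ c : Fin n → Fin Q, jointMass π f c g

theorem jointMass_eq (π : Fin Q → Fin Q → ℝ) (f : Fin Q → ℝ) (c : Fin n → Fin Q)
    (g : SimpleGraph (Fin n)) :
    jointMass π f c g = (∏ i, f (c i)) * graphMass (fun i j ↦ π (c i) (c j)) g := rfl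

/-- The law of the random graph is the mixture, over the classes, of its conditional laws. -/
theorem wsum_sbmMass (π : Fin Q → Fin Q → ℝ) (f : Fin Q → ℝ) (F : SimpleGraph (Fin n) → ℝ) :
    wsum (sbmMass π f) F = wsum (fun c : Fin n → Fin Q ↦ ∏ i, f (c i))
      (fun c ↦ wsum (graphMass fun i j ↦ π (c i) (c j)) F) := by
  simp only [wsum, sbmMass, jointMass_eq, Finset.sum_mul, Finset.mul_sum, mul_assoc]
  exact Finset.sum_comm

theorem sum_classMass {f : Fin Q → ℝ} (hf : ∑ a, f a = 1) :
    ∑ c : Fin n → Fin Q, ∏ i, f (c i) = 1 := by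
  have := Finset.prod_univ_sum (fun _ : Fin n ↦ (Finset.univ : Finset (Fin Q))) fun _ a ↦ f a
  rw [Fintype.piFinset_univ] at this
  simp [← this, hf]

theorem sbmMass_nonneg {π : Fin Q → Fin Q → ℝ} {f : Fin Q → ℝ} (hf : ∀ a, 0 ≤ f a)
    (hπ : ∀ a b, π a b ∈ Set.Icc (0 : ℝ) 1) (g : SimpleGraph (Fin n)) : 0 ≤ sbmMass π f g :=
  Finset.sum_nonneg fun c _ ↦ mul_nonneg (Finset.prod_nonneg fun _ _ ↦ hf _)
    (graphMass_nonneg (fun i j ↦ (hπ (c i) (c j)).1) (fun i j ↦ (hπ (c i) (c j)).2) g)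

theorem sum_sbmMass (π : Fin Q → Fin Q → ℝ) {f : Fin Q → ℝ} (hf : ∑ a, f a = 1) :
    ∑ g : SimpleGraph (Fin n), sbmMass π f g = 1 := by
  have := wsum_sbmMass (n := n) π f fun _ ↦ 1
  simp only [wsum_const (sum_graphMass _), wsum_const (sum_classMass hf)] at this
  simpa [wsum] using this

/-- Functions of the subgraphs of the stochastic block model induced on complementary vertex sets
are independent. -/
theorem wsum_sbmMass_mul (π : Fin Q → Fin Q → ℝ) {f : Fin Q → ℝ} (hf : ∑ a, f a = 1)
    {S : Set (Fin n)} {A B : SimpleGraph (Fin n) → ℝ} (hA : LocalOn S A) (hB : LocalOn Sᶜ B) :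
    wsum (sbmMass π f) (fun g ↦ A g * B g) = wsum (sbmMass π f) A * wsum (sbmMass π f) B := by
  classical
  -- Given the classes, the conditional expectations of `A` and `B` factor, and they depend on
  -- the classes of the vertices in `S` and in `Sᶜ` respectively.
  have hcond : ∀ c : Fin n → Fin Q, wsum (graphMass fun i j ↦ π (c i) (c j)) (fun g ↦ A g * B g) =
      wsum (graphMass fun i j ↦ π (c i) (c j)) A * wsum (graphMass fun i j ↦ π (c i) (c j)) B :=
    fun c ↦ (wsum_graphMass_mul (fun _ _ _ _ ↦ rfl) hA hB).symm
  simp only [wsum_sbmMass, hcond]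
  rw [wsum_mul_wsum_of_swap (fun c c' ↦ S.piecewise c c'), sum_classMass hf, one_mul]
  · intro c c'
    ext i
    by_cases hi : i ∈ S <;> simp [hi]
  · intro c c'
    simp only [← Finset.prod_mul_distrib]
    refine Finset.prod_congr rfl fun i _ ↦ ?_
    by_cases hi : i ∈ S <;> simp [hi, mul_comm]
  · intro c c'
    refine wsum_graphMass_congr (S := S) (fun i hi j hj ↦ ?_) hA
    simp [hi, hj]
  · intro c c'
    refine wsum_graphMass_congr (S := Sᶜ) (fun i hi j hj ↦ ?_) hB
    simp only [Set.mem_compl_iff] at hi hj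
    simp [hi, hj]

/-- Given that `F` is present, the presence of `F'` costs a factor `q` for each edge of `F'` that
is not in `F`. -/
theorem wsum_sbmMass_contains_mul_le {π : Fin Q → Fin Q → ℝ} {f : Fin Q → ℝ} {q : ℝ}
    (hf : ∀ a, 0 ≤ f a) (hπ : ∀ a b, 0 ≤ π a b) (hq : ∀ a b, π a b ≤ q)
    (F F' : SimpleGraph (Fin n)) :
    wsum (sbmMass π f) (fun g ↦ (containsInd F g : ℝ) * containsInd F' g) ≤
      wsum (sbmMass π f) (fun g ↦ containsInd F g) * q ^ (F' \ F).edgeSet.ncard := by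
  rw [wsum_sbmMass, wsum_sbmMass, mul_comm, ← wsum_const_mul]
  refine wsum_mono (fun c ↦ Finset.prod_nonneg fun _ _ ↦ hf _) fun c ↦ ?_
  rw [mul_comm]
  exact wsum_graphMass_contains_mul_le (fun i j ↦ hπ _ _) (fun i j ↦ hq _ _) F F'

theorem wsum_sbmMass_contains_le {π : Fin Q → Fin Q → ℝ} {f : Fin Q → ℝ} {q : ℝ}
    (hf : ∀ a, 0 ≤ f a) (hf1 : ∑ a, f a = 1) (hπ : ∀ a b, 0 ≤ π a b) (hq : ∀ a b, π a b ≤ q)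
    (F : SimpleGraph (Fin n)) :
    wsum (sbmMass π f) (fun g ↦ containsInd F g) ≤ q ^ F.edgeSet.ncard := by
  have := wsum_sbmMass_contains_mul_le (n := n) hf hπ hq ⊥ F
  simpa [containsInd, wsum_const (sum_sbmMass π hf1)] using this

instance instDiscreteMeasurableSpaceSimpleGraph {V : Type*} [Finite V] :
    DiscreteMeasurableSpace (SimpleGraph V) := by
  have : MeasurableSingletonClass (SimpleGraph V) := ⟨fun g ↦ by
    have h : ({g} : Set (SimpleGraph V)) = SimpleGraph.Adj ⁻¹' {g.Adj} := by
      ext g'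
      exact SimpleGraph.adj_inj.symm
    rw [h]
    exact ⟨_, measurableSet_singleton _, rfl⟩⟩
  infer_instance

theorem sbmLaw_real {π : Fin Q → Fin Q → ℝ} {f : Fin Q → ℝ}
    (hm : ∀ g : SimpleGraph (Fin n), 0 ≤ sbmMass π f g) (s : Set (SimpleGraph (Fin n))) :
    (sbmLaw n π f).real s = wsum (sbmMass π f) (s.indicator 1) := by
  rw [sbmLaw, measureReal_def, Measure.finsetSum_apply, ENNReal.toReal_sum]
  · refine Finset.sum_congr rfl fun g _ ↦ ?_
    change (ENNReal.ofReal (sbmMass π f g) * Measure.dirac g s).toReal = _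
    rw [ENNReal.toReal_mul, ENNReal.toReal_ofReal (hm g), Measure.dirac_apply' _ .of_discrete]
    by_cases hg : g ∈ s <;> simp [hg]
  · intro g _
    exact ENNReal.mul_ne_top ENNReal.ofReal_ne_top (measure_ne_top _ _)

theorem copyLaw_real {V : Type*} (G : SimpleGraph V) {π : Fin Q → Fin Q → ℝ} {f : Fin Q → ℝ}
    (hm : ∀ g : SimpleGraph (Fin n), 0 ≤ sbmMass π f g) (A : Set ℕ) :
    (copyLaw n π f G).real A =
      wsum (sbmMass π f) (fun g : SimpleGraph (Fin n) ↦ A.indicator 1 (g.copyCount G)) := by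
  rw [copyLaw, map_measureReal_apply .of_discrete .of_discrete, sbmLaw_real hm]
  rfl

theorem expectedCopies_eq {V : Type*} (G : SimpleGraph V) {π : Fin Q → Fin Q → ℝ} {f : Fin Q → ℝ}
    (hm : ∀ g : SimpleGraph (Fin n), 0 ≤ sbmMass π f g) :
    expectedCopies n π f G =
      wsum (sbmMass π f) (fun g : SimpleGraph (Fin n) ↦ (g.copyCount G : ℝ)) := by
  rw [expectedCopies, sbmLaw, integral_finsetSum_measure]
  · refine Finset.sum_congr rfl fun g _ ↦ ?_
    rw [integral_smul_measure, integral_dirac]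
    change (ENNReal.ofReal (sbmMass π f g)).toReal • _ = _
    rw [ENNReal.toReal_ofReal (hm g), smul_eq_mul]
  · intro g _
    exact (integrable_dirac (by simp)).smul_measure ENNReal.ofReal_ne_top

end SBM

/-! ### The exponent `κ` -/

section Exponent

variable {V : Type*} [Finite V] {G : SimpleGraph V}

theorem subE_le_numE (H : G.Subgraph) : subE H ≤ numE G :=
  Set.ncard_le_ncard H.edgeSet_subset (Set.toFinite _)

theorem alphaG_nonneg : 0 ≤ alphaG G := by
  refine Real.iInf_nonneg fun H ↦ div_nonneg ?_ ?_
  · exact sub_nonneg.2 (Nat.cast_le.2 (subE_le_numE H.1))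
  · exact sub_nonneg.2 (Nat.cast_le.2 H.2.2.le)

theorem kappa_nonneg {s : ℕ} (hs : s ≤ numV G) : 0 ≤ kappa G s :=
  le_max_of_le_right (mul_nonneg (sub_nonneg.2 (Nat.cast_le.2 hs)) alphaG_nonneg)

theorem kappa_le_of_admissible {H : G.Subgraph} (hH : Admissible H) {s : ℕ} (hHs : subV H ≤ s)
    (hs : s < numV G) : kappa G s ≤ numE G - subE H := by
  have hγ : gammaG G ≤ density G * subV H - subE H :=
    ciInf_le (Set.finite_range _).bddBelow (⟨H, hH⟩ : {H : G.Subgraph // Admissible H})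
  have hα : alphaG G ≤ ((numE G : ℝ) - subE H) / ((numV G : ℝ) - subV H) :=
    ciInf_le (Set.finite_range _).bddBelow
      (⟨H, hH, hHs.trans_lt hs⟩ : {H : G.Subgraph // Admissible H ∧ subV H < numV G})
  have hd : 0 ≤ density G := div_nonneg (Nat.cast_nonneg _) (Nat.cast_nonneg _)
  have hHs' : (subV H : ℝ) ≤ s := Nat.cast_le.2 hHs
  have hs' : (s : ℝ) < numV G := Nat.cast_lt.2 hs
  refine max_le ?_ ?_
  · nlinarith
  · rw [le_div_iff₀ (by linarith)] at hα
    nlinarith [alphaG_nonneg (G := G)]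

/-- The exponent `κ(G, s)` is at most the number of edges of `G` outside a subgraph without
isolated vertices that has at most `s` vertices. The subgraph without vertices is not admissible;
it is compared with a single edge, which has more edges and at most `s` vertices. -/
theorem kappa_le (hE : 1 < numE G) {H : G.Subgraph} (hH : ∀ x ∈ H.verts, ∃ y, H.Adj x y)
    {s : ℕ} (hs2 : 2 ≤ s) (hHs : subV H ≤ s) (hs : s < numV G) :
    kappa G s ≤ numE G - subE H := by
  rcases H.verts.eq_empty_or_nonempty with h | h
  · obtain ⟨e, he⟩ : G.edgeSet.Nonempty := by
      rw [← Set.ncard_pos]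
      exact zero_lt_one.trans hE
    induction e using Sym2.ind with
    | _ x y =>
    have hxy : G.Adj x y := he
    have hV : subV (G.subgraphOfAdj hxy) = 2 := by
      simp [subV, Set.ncard_pair hxy.ne]
    have hE1 : subE (G.subgraphOfAdj hxy) = 1 := by
      simp [subE]
    have hadm : Admissible (G.subgraphOfAdj hxy) := by
      refine ⟨fun htop ↦ ?_, ⟨x, by simp⟩, fun z hz ↦ ?_⟩
      · rw [htop, subE, SimpleGraph.Subgraph.edgeSet_top] at hE1
        exact hE.ne' hE1
      · simp only [SimpleGraph.subgraphOfAdj_verts, Set.mem_insert_iff,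
          Set.mem_singleton_iff] at hz
        rcases hz with rfl | rfl
        · exact ⟨y, by simp⟩
        · exact ⟨x, by simp⟩
    have h1 := kappa_le_of_admissible hadm (hV.trans_le hs2) hs
    have h0 : subE H = 0 := by
      rw [subE, Set.ncard_eq_zero]
      ext e
      induction e using Sym2.ind with
      | _ a b =>
        simp only [SimpleGraph.Subgraph.mem_edgeSet, Set.mem_empty_iff_false, iff_false]
        intro hab
        have := hab.fst_mem
        simp [h] at this
    rw [hE1] at h1
    rw [h0]
    push_cast at h1 ⊢
    linarith
  · refine kappa_le_of_admissible ⟨fun htop ↦ ?_, h, hH⟩ hHs hs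
    rw [htop, subV, SimpleGraph.Subgraph.verts_top, Set.ncard_univ] at hHs
    exact absurd hHs (not_le.2 hs)

end Exponent

/-! ### Copies of a graph and their overlaps -/

section Copies

variable {V W : Type*}

/-- The copies of `G` in the complete graph on `W`. -/
def Copies (G : SimpleGraph V) (W : Type*) : Type _ :=
  {H : (⊤ : SimpleGraph W).Subgraph // Nonempty (G ≃g H.coe)}

variable {G : SimpleGraph V}

/-- The vertex set of a copy. -/
def Copies.verts (a : Copies G W) : Set W := a.1.verts

/-- The edges of a copy, as a graph on all of `W`. -/
def Copies.graph (a : Copies G W) : SimpleGraph W := a.1.spanningCoe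

noncomputable instance [Finite W] : Fintype (Copies G W) :=
  have : Finite (Copies G W) := Subtype.finite
  Fintype.ofFinite _

theorem Copies.ext {a b : Copies G W} (hv : a.verts = b.verts) (hg : a.graph = b.graph) : a = b :=
  Subtype.ext (SimpleGraph.Subgraph.ext hv (SimpleGraph.Subgraph.spanningCoe_inj.1 hg))

theorem Copies.mem_verts_of_adj (a : Copies G W) {x y : W} (h : a.graph.Adj x y) :
    x ∈ a.verts ∧ y ∈ a.verts :=
  ⟨SimpleGraph.Subgraph.edge_vert _ h, SimpleGraph.Subgraph.edge_vert _ (a.1.adj_symm h)⟩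

theorem Copies.ncard_verts (a : Copies G W) : a.verts.ncard = numV G :=
  (Nat.card_congr a.2.some.toEquiv).symm

theorem Copies.ncard_edgeSet (a : Copies G W) : a.graph.edgeSet.ncard = numE G := by
  have h1 : a.1.coe.edgeSet.ncard = a.1.edgeSet.ncard := by
    rw [← SimpleGraph.Subgraph.image_coe_edgeSet_coe,
      Set.ncard_image_of_injective _ (Sym2.map.injective Subtype.val_injective)]
  rw [Copies.graph, SimpleGraph.Subgraph.edgeSet_spanningCoe, ← h1]
  exact (Nat.card_congr a.2.some.mapEdgeSet).symm

theorem copyCount_eq_sum [Fintype W] (G : SimpleGraph V) (g : SimpleGraph W) :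
    g.copyCount G = ∑ a : Copies G W, containsInd a.graph g := by
  classical
  simp only [containsInd, Finset.sum_boole, Nat.cast_id]
  rw [SimpleGraph.copyCount]
  refine Finset.card_bij' (fun H hH ↦ ⟨⟨H.verts, H.Adj, fun h ↦ (H.adj_sub h).ne, H.edge_vert,
      H.symm⟩, ?_⟩)
    (fun a ha ↦ ⟨a.1.verts, a.1.Adj, fun h ↦ ?_, a.1.edge_vert, a.1.symm⟩) ?_ ?_ ?_ ?_
  · exact (Finset.mem_filter.1 hH).2
  · exact (Finset.mem_filter.1 ha).2 h
  · intro H hH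
    exact Finset.mem_filter.2 ⟨Finset.mem_univ _, fun x y h ↦ H.adj_sub h⟩
  · intro a ha
    exact Finset.mem_filter.2 ⟨Finset.mem_univ _, a.2⟩
  · intro H hH
    rfl
  · intro a ha
    rfl

/-- There are at most `ρ(G)` copies of `G` on a given vertex set `T`: composing an isomorphism
onto each copy with the automorphisms of `G` gives distinct bijections onto `T`. -/
theorem card_copies_verts_eq_le [Finite V] [Finite W] (T : Set W) :
    (Nat.card {a : Copies G W // a.verts = T} : ℝ) ≤ rho G := by
  have hpos : 0 < Nat.card (G ≃g G) := by
    have : Finite (G ≃g G) := Finite.of_injective (fun e ↦ e.toEquiv) fun e e' h ↦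
      RelIso.toEquiv_injective h
    have : Nonempty (G ≃g G) := ⟨SimpleGraph.Iso.refl⟩
    exact Nat.card_pos
  rw [rho, le_div_iff₀ (by exact_mod_cast hpos)]
  norm_cast
  rcases isEmpty_or_nonempty {a : Copies G W // a.verts = T} with hemp | ⟨⟨a₀, ha₀⟩⟩
  · simp
  · let e₀ : V ≃ T := a₀.2.some.toEquiv.trans (Equiv.setCongr ha₀)
    have hequiv : Nat.card (V ≃ T) = (numV G).factorial := by
      classical
      have := Fintype.ofFinite V
      have := Fintype.ofFinite W
      have := Fintype.ofFinite T
      rw [Nat.card_eq_fintype_card, Fintype.card_equiv e₀, numV,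
        Nat.card_eq_fintype_card]
    rw [← hequiv, ← Nat.card_prod]
    refine Nat.card_le_card_of_injective (fun x : {a : Copies G W // a.verts = T} × (G ≃g G) ↦
      (x.2.toEquiv.trans x.1.1.2.some.toEquiv).trans (Equiv.setCongr x.1.2)) ?_
    rintro ⟨⟨a, ha⟩, σ⟩ ⟨⟨b, hb⟩, τ⟩ h
    have hval : ∀ x, (a.2.some (σ x) : W) = b.2.some (τ x) := fun x ↦
      congrArg (fun e : V ≃ T ↦ (e x : W)) h
    have hAdj : ∀ (c : Copies G W) (ρ : G ≃g G) (x y : V),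
        c.graph.Adj (c.2.some (ρ x)) (c.2.some (ρ y)) ↔ G.Adj x y := fun c ρ x y ↦
      (c.2.some.map_rel_iff (a := ρ x) (b := ρ y)).trans ρ.map_rel_iff
    have hab : a = b := by
      refine Copies.ext (ha.trans hb.symm) ?_
      have hsurj : ∀ (c : Copies G W) (ρ : G ≃g G) (w : W), w ∈ c.verts →
          ∃ x, (c.2.some (ρ x) : W) = w := fun c ρ w hw ↦
        ⟨ρ.symm (c.2.some.symm ⟨w, hw⟩), by simp⟩
      ext u w
      constructor
      · intro huw
        obtain ⟨x, rfl⟩ := hsurj a σ u (a.mem_verts_of_adj huw).1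
        obtain ⟨y, rfl⟩ := hsurj a σ w (a.mem_verts_of_adj huw).2
        rw [hval, hval, hAdj]
        rwa [hAdj] at huw
      · intro huw
        obtain ⟨x, rfl⟩ := hsurj b τ u (b.mem_verts_of_adj huw).1
        obtain ⟨y, rfl⟩ := hsurj b τ w (b.mem_verts_of_adj huw).2
        rw [← hval, ← hval, hAdj]
        rwa [hAdj] at huw
    subst hab
    have : σ = τ := by
      ext x
      exact a.2.some.injective (Subtype.ext (hval x))
    rw [this]

/-- The edges shared by the copies `a` and `b` form, inside `G ≅ a`, a subgraph without isolated
vertices. -/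
theorem Copies.exists_inter [Finite V] [Finite W] (a b : Copies G W) :
    ∃ H : G.Subgraph, (∀ x ∈ H.verts, ∃ y, H.Adj x y) ∧
      subV H ≤ (a.verts ∩ b.verts).ncard ∧
      (b.graph \ a.graph).edgeSet.ncard + subE H = numE G := by
  obtain ⟨e⟩ := a.2
  set φ : V → W := fun x ↦ (e x : W) with hφ
  have hinj : Function.Injective φ := Subtype.val_injective.comp e.injective
  have hadj : ∀ x y, a.graph.Adj (φ x) (φ y) ↔ G.Adj x y := fun x y ↦ e.map_rel_iff
  let H : G.Subgraph :=
    { verts := {x | ∃ y, G.Adj x y ∧ b.graph.Adj (φ x) (φ y)}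
      Adj := fun x y ↦ G.Adj x y ∧ b.graph.Adj (φ x) (φ y)
      adj_sub := fun h ↦ h.1
      edge_vert := fun {x y} h ↦ ⟨y, h⟩
      symm := ⟨fun x y h ↦ ⟨h.1.symm, h.2.symm⟩⟩ }
  refine ⟨H, fun x hx ↦ hx, ?_, ?_⟩
  · rw [subV, ← Set.ncard_image_of_injective _ hinj]
    refine Set.ncard_le_ncard ?_ (Set.toFinite _)
    rintro _ ⟨x, ⟨y, -, hxy⟩, rfl⟩
    exact ⟨(e x).2, (b.mem_verts_of_adj hxy).1⟩
  · have himg : Sym2.map φ '' H.edgeSet = b.graph.edgeSet ∩ a.graph.edgeSet := by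
      ext p
      induction p using Sym2.ind with
      | _ u w =>
      constructor
      · rintro ⟨p, hp, hpe⟩
        rw [← hpe]
        induction p using Sym2.ind with
        | _ x y => exact ⟨hp.2, (hadj x y).2 hp.1⟩
      · rintro ⟨hb, ha⟩
        have ha : a.graph.Adj u w := ha
        have hsurj : ∀ z ∈ a.verts, ∃ x, φ x = z := fun z hz ↦
          ⟨e.symm ⟨z, hz⟩, by simp [hφ]⟩
        obtain ⟨x, rfl⟩ := hsurj u (a.mem_verts_of_adj ha).1
        obtain ⟨y, rfl⟩ := hsurj w (a.mem_verts_of_adj ha).2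
        exact ⟨s(x, y), ⟨(hadj x y).1 ha, hb⟩, rfl⟩
    rw [subE, ← Set.ncard_image_of_injective _ (Sym2.map.injective hinj), himg,
      SimpleGraph.edgeSet_sdiff, add_comm,
      Set.ncard_inter_add_ncard_sdiff_eq_ncard _ _ (Set.toFinite _), b.ncard_edgeSet]

theorem Copies.ncard_sdiff_of_inter_le_one [Finite V] [Finite W] {a b : Copies G W}
    (h : (a.verts ∩ b.verts).ncard ≤ 1) :
    (b.graph \ a.graph).edgeSet.ncard = numE G := by
  rw [← b.ncard_edgeSet]
  congr 2
  rw [sdiff_eq_left, disjoint_iff_inf_le]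
  intro x y hxy
  have hb := b.mem_verts_of_adj hxy.1
  have ha := a.mem_verts_of_adj hxy.2
  exact hxy.1.ne ((Set.ncard_le_one (Set.toFinite _)).1 h x ⟨ha.1, hb.1⟩ y ⟨ha.2, hb.2⟩)

theorem Copies.ncard_sdiff_pos [Finite V] [Finite W] {a b : Copies G W} (hab : a ≠ b)
    (h : a.verts = b.verts) : 1 ≤ (b.graph \ a.graph).edgeSet.ncard := by
  rw [Nat.one_le_iff_ne_zero, Ne, Set.ncard_eq_zero, SimpleGraph.edgeSet_sdiff,
    Set.sdiff_eq_empty]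
  intro hsub
  refine hab (Copies.ext h ?_)
  rw [← SimpleGraph.edgeSet_inj]
  exact (Set.eq_of_subset_of_ncard_le hsub (by rw [a.ncard_edgeSet, b.ncard_edgeSet])
    (Set.toFinite _)).symm

end Copies

/-! ### Counting copies by overlap -/

section Counting

variable {V : Type*} [Finite V] {G : SimpleGraph V} {n : ℕ}

open Classical in
theorem card_copies_toFinset_mem_le (𝒯 : Finset (Finset (Fin n))) :
    ((Finset.univ.filter fun b : Copies G (Fin n) ↦ b.verts.toFinset ∈ 𝒯).card : ℝ) ≤
      𝒯.card * rho G := by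
  have hfib := Finset.card_eq_sum_card_fiberwise
    (s := Finset.univ.filter fun b : Copies G (Fin n) ↦ b.verts.toFinset ∈ 𝒯)
    (f := fun b : Copies G (Fin n) ↦ b.verts.toFinset) (t := 𝒯)
    fun b hb ↦ (Finset.mem_filter.1 hb).2
  rw [hfib, Nat.cast_sum, ← nsmul_eq_mul]
  refine Finset.sum_le_card_nsmul _ _ _ fun T _ ↦ ?_
  refine le_trans ?_ (card_copies_verts_eq_le (G := G) (T : Set (Fin n)))
  rw [Nat.card_eq_fintype_card, Fintype.card_subtype]
  refine Nat.cast_le.2 (Finset.card_le_card fun b hb ↦ ?_)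
  rw [Finset.mem_filter] at hb ⊢
  refine ⟨Finset.mem_univ _, ?_⟩
  rw [← hb.2, Set.coe_toFinset]

theorem card_filter_inter_card_eq_le (S : Finset (Fin n)) (v s : ℕ) :
    (((Finset.powersetCard v Finset.univ).filter fun T ↦ (S ∩ T).card = s).card : ℝ) ≤
      (S.card.choose s : ℝ) * ((n : ℝ) ^ (v - s) / (v - s).factorial) := by
  have h1 : ((Finset.powersetCard v Finset.univ).filter fun T ↦ (S ∩ T).card = s).card ≤
      ((Finset.powersetCard s S) ×ˢ
        (Finset.powersetCard (v - s) (Finset.univ : Finset (Fin n)))).card := by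
    refine Finset.card_le_card_of_injOn (fun T ↦ (S ∩ T, T \ S)) (fun T hT ↦ ?_)
      fun T _ T' _ h ↦ ?_
    · simp only [Finset.coe_filter, Finset.mem_powersetCard_univ, Set.mem_ofPred_eq] at hT
      simp only [Finset.coe_product, Set.mem_prod, Finset.mem_coe, Finset.mem_powersetCard,
        Finset.inter_subset_left, hT.2, true_and, Finset.subset_univ]
      rw [Finset.card_sdiff, hT.1, hT.2]
    · obtain ⟨h1, h2⟩ := Prod.ext_iff.1 h
      simp only at h1 h2
      rw [← Finset.sdiff_union_inter T S, ← Finset.sdiff_union_inter T' S, Finset.inter_comm T,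
        Finset.inter_comm T', h1, h2]
  rw [Finset.card_product, Finset.card_powersetCard, Finset.card_powersetCard, Finset.card_univ,
    Fintype.card_fin] at h1
  refine (Nat.cast_le.2 h1).trans ?_
  rw [Nat.cast_mul]
  exact mul_le_mul_of_nonneg_left (Nat.choose_le_pow_div _ _) (Nat.cast_nonneg _)

theorem card_filter_not_disjoint_le (S : Finset (Fin n)) (v : ℕ) :
    (((Finset.powersetCard v Finset.univ).filter fun T ↦ ¬Disjoint S T).card : ℝ) ≤
      S.card * ((n : ℝ) ^ (v - 1) / (v - 1).factorial) := by
  rcases S.eq_empty_or_nonempty with rfl | ⟨x₀, -⟩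
  · simp
  have : Nonempty (Fin n) := ⟨x₀⟩
  have h1 : ((Finset.powersetCard v Finset.univ).filter fun T ↦ ¬Disjoint S T).card ≤
      (S ×ˢ (Finset.powersetCard (v - 1) (Finset.univ : Finset (Fin n)))).card := by
    have hex : ∀ T : Finset (Fin n), ¬Disjoint S T → ∃ x, x ∈ S ∧ x ∈ T := fun T hT ↦
      Finset.not_disjoint_iff.1 hT
    choose! x hxS hxT using hex
    refine Finset.card_le_card_of_injOn (fun T ↦ (x T, T.erase (x T))) (fun T hT ↦ ?_)
      fun T hT T' hT' h ↦ ?_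
    · simp only [Finset.coe_filter, Finset.mem_powersetCard_univ, Set.mem_ofPred_eq] at hT
      simp only [Finset.coe_product, Set.mem_prod, Finset.mem_coe, Finset.mem_powersetCard_univ]
      exact ⟨hxS T hT.2, by rw [Finset.card_erase_of_mem (hxT T hT.2), hT.1]⟩
    · obtain ⟨h1, h2⟩ := Prod.ext_iff.1 h
      simp only at h1 h2
      rw [← Finset.insert_erase (hxT T (Finset.mem_filter.1 hT).2), h2, h1,
        Finset.insert_erase (hxT T' (Finset.mem_filter.1 hT').2)]
  rw [Finset.card_product, Finset.card_powersetCard, Finset.card_univ, Fintype.card_fin] at h1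
  refine (Nat.cast_le.2 h1).trans ?_
  rw [Nat.cast_mul]
  exact mul_le_mul_of_nonneg_left (Nat.choose_le_pow_div _ _) (Nat.cast_nonneg _)

end Counting

/-! ### Sums over the neighbourhood of a copy -/

section Neighbourhood

variable {V : Type*} {G : SimpleGraph V} {n : ℕ}

/-- The bound for the conditional probability that a copy is present, given that another copy
that shares `s ≥ 1` vertices with it is present. -/
noncomputable def overlapBound (G : SimpleGraph V) (q : ℝ) (s : ℕ) : ℝ :=
  if s = 1 then q ^ numE G else if s = numV G then q else q ^ kappa G s

theorem overlapBound_nonneg {q : ℝ} (hq : 0 ≤ q) (s : ℕ) : 0 ≤ overlapBound G q s := by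
  unfold overlapBound
  split_ifs <;> positivity

variable [Finite V]

theorem pow_ncard_sdiff_le_overlapBound (hE : 1 < numE G) {q : ℝ} (hq0 : 0 ≤ q) (hq1 : q ≤ 1)
    {a b : Copies G (Fin n)} (hab : a ≠ b) (hmeet : (a.verts ∩ b.verts).Nonempty) :
    q ^ (b.graph \ a.graph).edgeSet.ncard ≤ overlapBound G q (a.verts ∩ b.verts).ncard := by
  unfold overlapBound
  have hpos : 0 < (a.verts ∩ b.verts).ncard := (Set.ncard_pos (Set.toFinite _)).2 hmeet
  split_ifs with h1 h2
  · rw [Copies.ncard_sdiff_of_inter_le_one h1.le]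
  · have hv : a.verts = b.verts := by
      have ha : a.verts ∩ b.verts = a.verts := Set.eq_of_subset_of_ncard_le
        Set.inter_subset_left (by rw [h2, a.ncard_verts]) (Set.toFinite _)
      have hb : a.verts ∩ b.verts = b.verts := Set.eq_of_subset_of_ncard_le
        Set.inter_subset_right (by rw [h2, b.ncard_verts]) (Set.toFinite _)
      exact ha.symm.trans hb
    exact pow_le_of_le_one hq0 hq1 (Nat.one_le_iff_ne_zero.1 (Copies.ncard_sdiff_pos hab hv))
  · have hlt : (a.verts ∩ b.verts).ncard < numV G := by
      refine lt_of_le_of_ne ?_ h2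
      rw [← a.ncard_verts]
      exact Set.ncard_le_ncard Set.inter_subset_left (Set.toFinite _)
    obtain ⟨H, hH, hHs, hHe⟩ := a.exists_inter b
    have hκ := kappa_le hE hH (by omega) hHs hlt
    rw [← Real.rpow_natCast]
    refine Real.rpow_le_rpow_of_exponent_ge' hq0 hq1 (kappa_nonneg hlt.le) (hκ.trans_eq ?_)
    rw [← hHe]
    push_cast
    ring

open Classical in
/-- The copies that share a vertex with `a`. -/
noncomputable def Copies.nbhd (a : Copies G (Fin n)) : Finset (Copies G (Fin n)) :=
  Finset.univ.filter fun b ↦ ¬Disjoint a.verts b.verts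

theorem Copies.card_nbhd_le (a : Copies G (Fin n)) :
    (a.nbhd.card : ℝ) ≤
      rho G * (numV G * ((n : ℝ) ^ (numV G - 1) / (numV G - 1).factorial)) := by
  classical
  have hS : a.verts.toFinset.card = numV G := by
    rw [← a.ncard_verts, Set.ncard_eq_toFinset_card']
  have h1 := card_copies_toFinset_mem_le (G := G)
    ((Finset.powersetCard (numV G) Finset.univ).filter fun T ↦ ¬Disjoint a.verts.toFinset T)
  have h2 := card_filter_not_disjoint_le a.verts.toFinset (numV G)
  rw [hS] at h2
  have hρ : 0 ≤ rho G := div_nonneg (Nat.cast_nonneg _) (Nat.cast_nonneg _)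
  refine le_trans (Nat.cast_le.2 (Finset.card_le_card fun b hb ↦ ?_))
    (h1.trans ((mul_le_mul_of_nonneg_right h2 hρ).trans_eq (mul_comm _ _)))
  rw [Copies.nbhd, Finset.mem_filter] at hb
  simp only [Finset.mem_filter, Finset.mem_univ, true_and, Finset.mem_powersetCard_univ,
    Set.disjoint_toFinset]
  exact ⟨by rw [← b.ncard_verts, Set.ncard_eq_toFinset_card'], hb.2⟩

open Classical in
theorem Copies.sum_nbhd_erase_le (hE : 1 < numE G) {q : ℝ} (hq0 : 0 ≤ q) (hq1 : q ≤ 1)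
    (a : Copies G (Fin n)) :
    ∑ b ∈ a.nbhd.erase a, q ^ (b.graph \ a.graph).edgeSet.ncard ≤
      rho G * ∑ s ∈ Finset.Icc 1 (numV G), (numV G).choose s *
        ((n : ℝ) ^ (numV G - s) / (numV G - s).factorial) * overlapBound G q s := by
  have hS : ∀ b : Copies G (Fin n), b.verts.toFinset.card = numV G := fun b ↦ by
    rw [← b.ncard_verts, Set.ncard_eq_toFinset_card']
  have hmeet : ∀ b ∈ a.nbhd.erase a, (a.verts ∩ b.verts).Nonempty := fun b hb ↦
    Set.not_disjoint_iff_nonempty_inter.1 (Finset.mem_filter.1 (Finset.mem_of_mem_erase hb)).2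
  have hρ : 0 ≤ rho G := div_nonneg (Nat.cast_nonneg _) (Nat.cast_nonneg _)
  rw [Finset.mul_sum, ← Finset.sum_fiberwise_of_maps_to
    (g := fun b : Copies G (Fin n) ↦ (a.verts ∩ b.verts).ncard) (t := Finset.Icc 1 (numV G))]
  · refine Finset.sum_le_sum fun s _ ↦ ?_
    have hcard : (((a.nbhd.erase a).filter fun b ↦ (a.verts ∩ b.verts).ncard = s).card : ℝ) ≤
        rho G * ((numV G).choose s *
          ((n : ℝ) ^ (numV G - s) / (numV G - s).factorial)) := by
      have h1 := card_copies_toFinset_mem_le (G := G)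
        ((Finset.powersetCard (numV G) Finset.univ).filter
          fun T ↦ (a.verts.toFinset ∩ T).card = s)
      have h2 := card_filter_inter_card_eq_le a.verts.toFinset (numV G) s
      rw [hS a] at h2
      refine le_trans (Nat.cast_le.2 (Finset.card_le_card fun b hb ↦ ?_))
        (h1.trans ((mul_le_mul_of_nonneg_right h2 hρ).trans_eq (mul_comm _ _)))
      rw [Finset.mem_filter] at hb
      simp only [Finset.mem_filter, Finset.mem_univ, true_and, Finset.mem_powersetCard_univ]
      refine ⟨hS b, ?_⟩
      rw [← hb.2, ← Set.toFinset_inter, Set.ncard_eq_toFinset_card']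
    rw [← mul_assoc]
    refine le_trans ?_ (mul_le_mul_of_nonneg_right hcard (overlapBound_nonneg hq0 s))
    rw [← nsmul_eq_mul]
    refine Finset.sum_le_card_nsmul _ _ _ fun b hb ↦ ?_
    obtain ⟨hb1, hb2⟩ := Finset.mem_filter.1 hb
    rw [← hb2]
    exact pow_ncard_sdiff_le_overlapBound hE hq0 hq1 (Finset.ne_of_mem_erase hb1).symm
      (hmeet b hb1)
  · intro b hb
    refine Finset.mem_Icc.2 ⟨(Set.ncard_pos (Set.toFinite _)).2 (hmeet b hb), ?_⟩
    rw [← a.ncard_verts]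
    exact Set.ncard_le_ncard Set.inter_subset_left (Set.toFinite _)

theorem one_lt_numV (hE : 1 < numE G) : 1 < numV G := by
  obtain ⟨e, he⟩ : G.edgeSet.Nonempty := by
    rw [← Set.ncard_pos]
    exact zero_lt_one.trans hE
  induction e using Sym2.ind with
  | _ x y =>
    have hxy : G.Adj x y := he
    exact Finite.one_lt_card_iff_nontrivial.2 ⟨x, y, hxy.ne⟩

/-- The sum over the sizes of the overlap, plus the bound for the first-moment terms, is the
bracket of the theorem. -/
theorem overlap_sum_eq (hE : 1 < numE G) (q : ℝ) :
    (numV G * ((n : ℝ) ^ (numV G - 1) / (numV G - 1).factorial)) * q ^ numE G +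
      ∑ s ∈ Finset.Icc 1 (numV G), (numV G).choose s *
        ((n : ℝ) ^ (numV G - s) / (numV G - s).factorial) * overlapBound G q s =
    2 * (numV G : ℝ) ^ 2 / ((numV G).factorial : ℝ) * (n : ℝ) ^ (numV G - 1) * q ^ numE G + q +
      ∑ s ∈ Finset.Icc 2 (numV G - 1), ((numV G).choose s : ℝ) *
        ((n : ℝ) ^ (numV G - s) * q ^ kappa G s / ((numV G - s).factorial : ℝ)) := by
  have hv := one_lt_numV hE
  obtain ⟨m, hm⟩ : ∃ m, numV G = m + 2 := ⟨numV G - 2, by omega⟩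
  have hIcc : Finset.Icc 1 (numV G) = insert 1 (insert (numV G) (Finset.Icc 2 (numV G - 1))) := by
    ext s
    simp only [Finset.mem_Icc, Finset.mem_insert]
    omega
  rw [hIcc, Finset.sum_insert, Finset.sum_insert]
  · have hmid : ∀ s ∈ Finset.Icc 2 (numV G - 1), ((numV G).choose s : ℝ) *
          ((n : ℝ) ^ (numV G - s) / (numV G - s).factorial) * overlapBound G q s =
        ((numV G).choose s : ℝ) *
          ((n : ℝ) ^ (numV G - s) * q ^ kappa G s / ((numV G - s).factorial : ℝ)) := by
      intro s hs
      rw [Finset.mem_Icc] at hs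
      rw [overlapBound, if_neg (by omega), if_neg (by omega)]
      ring
    rw [Finset.sum_congr rfl hmid]
    have h1 : overlapBound G q 1 = q ^ numE G := if_pos rfl
    have hv' : overlapBound G q (numV G) = q := by
      rw [overlapBound, if_neg (by omega), if_pos rfl]
    rw [h1, hv', Nat.choose_self, Nat.choose_one_right, Nat.sub_self]
    have hfac : ((numV G).factorial : ℝ) = numV G * (numV G - 1).factorial := by
      rw [hm]
      exact_mod_cast Nat.factorial_succ (m + 1)
    rw [hfac]
    have h0 : (numV G : ℝ) ≠ 0 := by rw [hm]; positivity
    simp only [pow_zero, Nat.factorial_zero, Nat.cast_one]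
    field_simp
    ring
  · simp only [Finset.mem_Icc]
    omega
  · simp only [Finset.mem_Icc, Finset.mem_insert]
    omega

end Neighbourhood

/-! ### Independence outside the neighbourhood -/

section Independence

variable {V : Type*} {G : SimpleGraph V} {n : ℕ}

theorem localOn_containsInd {W : Type*} (a : Copies G W) {S : Set W} (h : a.verts ⊆ S) :
    LocalOn S (fun g ↦ containsInd a.graph g) := by
  intro g g' hg
  have : a.graph ≤ g ↔ a.graph ≤ g' := by
    refine forall_congr' fun i ↦ forall_congr' fun j ↦ forall_congr' fun hij ↦ ?_
    have := a.mem_verts_of_adj hij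
    exact hg i (h this.1) j (h this.2)
  by_cases hg' : a.graph ≤ g' <;> simp only [containsInd, this, hg', if_true, if_false]

open Classical in
theorem localOn_sum_compl_nbhd (a : Copies G (Fin n)) :
    LocalOn (a.verts)ᶜ (fun g ↦ ∑ b ∈ (a.nbhd)ᶜ, containsInd b.graph g) := by
  intro g g' hg
  refine Finset.sum_congr rfl fun b hb ↦ localOn_containsInd b ?_ g g' hg
  simp only [Copies.nbhd, Finset.mem_compl, Finset.mem_filter, Finset.mem_univ, true_and,
    not_not] at hb
  exact Set.subset_compl_iff_disjoint_left.2 hb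

end Independence

/-! ### The degenerate case and the total variation bound -/

theorem maxEdgeProb_mem {Q : ℕ} {π : Fin Q → Fin Q → ℝ}
    (hπ : ∀ a b, π a b ∈ Set.Icc (0 : ℝ) 1) :
    (∀ a b, π a b ≤ maxEdgeProb π) ∧ maxEdgeProb π ∈ Set.Icc (0 : ℝ) 1 :=
  ⟨fun a b ↦ le_ciSup (f := fun ab : Fin Q × Fin Q ↦ π ab.1 ab.2)
      (Set.finite_range _).bddAbove (a, b),
    Real.iSup_nonneg fun _ ↦ (hπ _ _).1, Real.iSup_le (fun _ ↦ (hπ _ _).2) zero_le_one⟩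

theorem poissonMeasure_zero_real (A : Set ℕ) :
    (poissonMeasure 0).real A = A.indicator 1 0 := by
  have h0 : (poissonMeasure 0).real {0} = 1 := by simp [poissonMeasure_real_singleton]
  by_cases h : 0 ∈ A
  · rw [Set.indicator_of_mem h]
    refine le_antisymm measureReal_le_one ?_
    rw [Pi.one_apply, ← h0]
    exact measureReal_mono (Set.singleton_subset_iff.2 h)
  · rw [Set.indicator_of_notMem h]
    refine le_antisymm ?_ measureReal_nonneg
    have h1 : (poissonMeasure 0).real ({0}ᶜ : Set ℕ) = 0 := by
      rw [probReal_compl_eq_one_sub .of_discrete, h0, sub_self]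
    rw [← h1]
    exact measureReal_mono (Set.subset_compl_singleton_iff.2 h)

/-- A law on `ℕ` with mean `0` is the point mass at `0`. -/
theorem wsum_indicator_of_wsum_eq_zero {Ω : Type*} [Fintype Ω] {p : Ω → ℝ} (hp : ∀ ω, 0 ≤ p ω)
    (hp1 : ∑ ω, p ω = 1) {W : Ω → ℕ} (hW : wsum p (fun ω ↦ (W ω : ℝ)) = 0) (A : Set ℕ) :
    wsum p (fun ω ↦ A.indicator 1 (W ω)) = A.indicator 1 0 := by
  rw [wsum, Finset.sum_eq_zero_iff_of_nonneg fun ω _ ↦ mul_nonneg (hp ω) (Nat.cast_nonneg _)] at hW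
  rw [← wsum_const hp1 (A.indicator 1 0)]
  refine Finset.sum_congr rfl fun ω hω ↦ ?_
  rcases mul_eq_zero.1 (hW ω hω) with h | h
  · simp [h]
  · simp only [Nat.cast_eq_zero.1 h]

end SBMPoisson

open SBMPoisson

theorem theorem2p1 {V : Type*} [Finite V] (G : SimpleGraph V)
    (hE : 1 < SBMPoisson.numE G) (hG : SBMPoisson.StrictlyBalanced G)
    (n Q : ℕ) (π : Fin Q → Fin Q → ℝ) (f : Fin Q → ℝ)
    (hf_pos : ∀ a, 0 < f a) (hf_sum : ∑ a, f a = 1)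
    (hπ_symm : ∀ a b, π a b = π b a) (hπ_mem : ∀ a b, π a b ∈ Set.Icc (0 : ℝ) 1) :
    SBMPoisson.tvDist (SBMPoisson.copyLaw n π f G)
        (poissonMeasure (SBMPoisson.expectedCopies n π f G).toNNReal) ≤
      (1 - Real.exp (-SBMPoisson.expectedCopies n π f G)) * SBMPoisson.rho G *
        (2 * (SBMPoisson.numV G : ℝ) ^ 2 / ((SBMPoisson.numV G).factorial : ℝ) *
            (n : ℝ) ^ (SBMPoisson.numV G - 1) *
            SBMPoisson.maxEdgeProb π ^ SBMPoisson.numE G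
          + SBMPoisson.maxEdgeProb π
          + ∑ s ∈ Finset.Icc 2 (SBMPoisson.numV G - 1),
              ((SBMPoisson.numV G).choose s : ℝ) *
                ((n : ℝ) ^ (SBMPoisson.numV G - s) *
                    SBMPoisson.maxEdgeProb π ^ SBMPoisson.kappa G s /
                  ((SBMPoisson.numV G - s).factorial : ℝ))) := by
  classical
  obtain ⟨hπq, hq0, hq1⟩ := maxEdgeProb_mem hπ_mem
  have hf0 : ∀ a, 0 ≤ f a := fun a ↦ (hf_pos a).le
  have hm : ∀ g : SimpleGraph (Fin n), 0 ≤ sbmMass π f g := sbmMass_nonneg hf0 hπ_mem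
  have hm1 : ∑ g : SimpleGraph (Fin n), sbmMass π f g = 1 := sum_sbmMass π hf_sum
  have hlam := expectedCopies_eq G hm
  have hlam0 : 0 ≤ expectedCopies n π f G := by
    rw [hlam]
    exact wsum_nonneg hm fun g ↦ Nat.cast_nonneg _
  rw [← overlap_sum_eq (n := n) hE (maxEdgeProb π)]
  refine ciSup_le fun A ↦ ?_
  rw [copyLaw_real G hm]
  rcases hlam0.eq_or_lt with h0 | hpos
  -- For `λ = 0` both laws are the point mass at `0`, and both sides vanish.
  · rw [← h0, Real.toNNReal_zero, poissonMeasure_zero_real,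
      wsum_indicator_of_wsum_eq_zero hm hm1 (hlam.symm.trans h0.symm)]
    simp
  set q := maxEdgeProb π
  set p : Copies G (Fin n) → ℝ := fun a ↦ wsum (sbmMass π f) (fun g ↦ containsInd a.graph g)
    with hp
  have hp0 : ∀ a, 0 ≤ p a := fun a ↦ wsum_nonneg hm fun g ↦ Nat.cast_nonneg _
  set r := (expectedCopies n π f G).toNNReal with hr
  have hrcoe : (r : ℝ) = expectedCopies n π f G := Real.coe_toNNReal _ hlam0
  have hsum : (r : ℝ) = ∑ a, p a := by
    rw [hrcoe, hlam, hp, ← wsum_sum]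
    simp only [copyCount_eq_sum, Nat.cast_sum]
  have hstein := chenStein_local hm hm1 (fun (a : Copies G (Fin n)) g ↦ containsInd a.graph g)
    (fun a g ↦ by unfold containsInd; split_ifs <;> simp) Copies.nbhd (fun a ↦ ?_) (fun a h ↦ ?_)
    (Real.toNNReal_pos.2 hpos) hsum A
  rotate_left
  · have : a.verts.Nonempty := by
      rw [← Set.ncard_pos (Set.toFinite _), a.ncard_verts]
      exact zero_lt_one.trans (one_lt_numV hE)
    simpa [Copies.nbhd, ← Set.nonempty_iff_ne_empty] using this
  · exact wsum_sbmMass_mul π hf_sum (S := a.verts)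
      (fun g g' hg ↦ congrArg Nat.cast (localOn_containsInd a subset_rfl g g' hg))
      (fun g g' hg ↦ congrArg h (localOn_sum_compl_nbhd a g g' hg))
  simp only [copyCount_eq_sum]
  refine hstein.trans ?_
  have hC : 0 ≤ (1 - Real.exp (-(r : ℝ))) / r := by
    refine div_nonneg (sub_nonneg.2 (Real.exp_le_one_iff.2 ?_)) r.2
    exact neg_nonpos.2 r.2
  set K := (numV G * ((n : ℝ) ^ (numV G - 1) / (numV G - 1).factorial)) * q ^ numE G +
      ∑ s ∈ Finset.Icc 1 (numV G), (numV G).choose s *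
        ((n : ℝ) ^ (numV G - s) / (numV G - s).factorial) * overlapBound G q s with hK
  have hterm : ∀ a ∈ (Finset.univ : Finset (Copies G (Fin n))),
      p a * ∑ b ∈ a.nbhd, p b + ∑ b ∈ a.nbhd.erase a,
        wsum (sbmMass π f) (fun g ↦ (containsInd a.graph g : ℝ) * containsInd b.graph g) ≤
      p a * (rho G * K) := by
    intro a _
    rw [hK, mul_add, mul_add]
    refine add_le_add (mul_le_mul_of_nonneg_left ?_ (hp0 a)) ?_
    · rw [← mul_assoc]
      refine le_trans ?_ (mul_le_mul_of_nonneg_right a.card_nbhd_le (pow_nonneg hq0 _))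
      rw [← nsmul_eq_mul]
      refine Finset.sum_le_card_nsmul _ _ _ fun b _ ↦ ?_
      rw [← b.ncard_edgeSet]
      exact wsum_sbmMass_contains_le hf0 hf_sum (fun x y ↦ (hπ_mem x y).1) hπq b.graph
    · refine le_trans ?_ (mul_le_mul_of_nonneg_left (a.sum_nbhd_erase_le hE hq0 hq1) (hp0 a))
      rw [Finset.mul_sum]
      exact Finset.sum_le_sum fun b _ ↦
        wsum_sbmMass_contains_mul_le hf0 (fun x y ↦ (hπ_mem x y).1) hπq a.graph b.graph
  refine (mul_le_mul_of_nonneg_left (Finset.sum_le_sum hterm) hC).trans_eq ?_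
  rw [← Finset.sum_mul, ← hsum, ← hrcoe]
  have hr0 : (r : ℝ) ≠ 0 := by rw [hrcoe]; exact hpos.ne'
  field_simp
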